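/- **Proposition 5.1.** Consider continuous first-order logic in the language of C$^*$-algebras: atomic formulas are norms $\|p(x_1,\dots,x_n)\|$ of complex $*$-polynomials $p$ without constant term, connectives are continuous functions $\mathbb{R}^k\to\mathbb{R}$, and quantifiers are suprema and infima over the closed unit ball; for a sentence $\varphi$ (a formula without free variables) let $\varphi^A\in\mathbb{R}$ be its value in the C$^*$-algebra $A$. A C$^*$-algebra $A$ is *pseudocompact* if $\varphi^A=0$ for every sentence $\varphi$ such that $\varphi^F=0$ for all finite-dimensional C$^*$-algebras $F$. Let $A$ be a pseudocompact C$^*$-algebra. Then $A$ is unital, and every unitary of $A$ is homotopic to the identity, i.e. is joined to $1$ by a norm-continuous path in the unitary group $U(A)$; in particular $U(A)$ is connected. Moreover the group $$K_1(A)=\varinjlim_n\, U(M_n(A))/U(M_n(A))_0$$ is trivial, where $U(M_n(A))_0$ is the path component of the identity and the connecting maps are induced by $u\mapsto\operatorname{diag}(u,1)$. -/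

import Mathlib

universe u

/-! ### Continuous first-order logic for C⋆-algebras -/

namespace CStarLogic

/-- Terms of the language of C⋆-algebras in the variables `x₀, …, xₙ₋₁`: formal `*`-polynomials
with complex coefficients (and without constant term, since the algebra need not be unital). -/
inductive Term (n : ℕ) : Type
  | var (i : Fin n) : Term n
  | zero : Term n
  | add (s t : Term n) : Term n
  | mul (s t : Term n) : Term n
  | smul (c : ℂ) (t : Term n) : Term n
  | star (t : Term n) : Term n

/-- Formulas of the language of C⋆-algebras whose free variables are among `x₀, …, xₙ₋₁`. Atomic
formulas are norms of terms, the connectives are all continuous functions `ℝᵏ → ℝ`, and the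
quantifiers are the supremum and the infimum over the closed unit ball. A quantifier binds the
variable `x₀` of its body, and `xᵢ₊₁` of the body is `xᵢ` of the quantified formula. -/
inductive Formula : ℕ → Type
  | norm {n : ℕ} (t : Term n) : Formula n
  | conn {n k : ℕ} (f : C(Fin k → ℝ, ℝ)) (φ : Fin k → Formula n) : Formula n
  | sup {n : ℕ} (φ : Formula (n + 1)) : Formula n
  | inf {n : ℕ} (φ : Formula (n + 1)) : Formula n

/-- A sentence is a formula without free variables. -/
abbrev Sentence : Type := Formula 0

variable (A : Type u) [NonUnitalCStarAlgebra A]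

/-- The value of a term in the C⋆-algebra `A` at an assignment `v` of its variables. -/
def Term.eval {n : ℕ} : Term n → (Fin n → A) → A
  | .var i, v => v i
  | .zero, _ => 0
  | .add s t, v => s.eval v + t.eval v
  | .mul s t, v => s.eval v * t.eval v
  | .smul c t, v => c • t.eval v
  | .star t, v => Star.star (t.eval v)

/-- The value of a formula in the C⋆-algebra `A` at an assignment `v` of its variables. At an
assignment in the closed unit ball all suprema and infima are of bounded nonempty families, see
`CStarLogic.Formula.exists_abs_eval_le`. -/
noncomputable def Formula.eval : {n : ℕ} → Formula n → (Fin n → A) → ℝ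
  | _, .norm t, v => ‖t.eval A v‖
  | _, .conn f φ, v => f fun j => (φ j).eval v
  | _, .sup φ, v => ⨆ x : Metric.closedBall (0 : A) 1, φ.eval (Fin.cons (x : A) v)
  | _, .inf φ, v => ⨅ x : Metric.closedBall (0 : A) 1, φ.eval (Fin.cons (x : A) v)

/-- The value `φ^A` of a sentence `φ` in the C⋆-algebra `A`. -/
noncomputable def Sentence.value (φ : Sentence) : ℝ := Formula.eval A φ Fin.elim0

theorem Term.exists_norm_eval_le {n : ℕ} (t : Term n) :
    ∃ C : ℝ, ∀ v : Fin n → A, (∀ i, ‖v i‖ ≤ 1) → ‖t.eval A v‖ ≤ C := by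
  induction t with
  | var i => exact ⟨1, fun v hv => hv i⟩
  | zero => exact ⟨0, fun v hv => by simp [Term.eval]⟩
  | add s t hs ht =>
    obtain ⟨C, hC⟩ := hs
    obtain ⟨D, hD⟩ := ht
    exact ⟨C + D, fun v hv => (norm_add_le _ _).trans (add_le_add (hC v hv) (hD v hv))⟩
  | mul s t hs ht =>
    obtain ⟨C, hC⟩ := hs
    obtain ⟨D, hD⟩ := ht
    exact ⟨C * D, fun v hv => (norm_mul_le _ _).trans
      (mul_le_mul (hC v hv) (hD v hv) (norm_nonneg _) ((norm_nonneg _).trans (hC v hv)))⟩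
  | smul c t ht =>
    obtain ⟨D, hD⟩ := ht
    exact ⟨‖c‖ * D, fun v hv => (norm_smul_le _ _).trans
      (mul_le_mul_of_nonneg_left (hD v hv) (norm_nonneg _))⟩
  | star t ht =>
    obtain ⟨D, hD⟩ := ht
    exact ⟨D, fun v hv => (norm_star _).trans_le (hD v hv)⟩

/-- Formulas are bounded on the closed unit ball, so that no supremum or infimum in the value of a
sentence is taken over an unbounded family. -/
theorem Formula.exists_abs_eval_le {n : ℕ} (φ : Formula n) :
    ∃ C : ℝ, ∀ v : Fin n → A, (∀ i, ‖v i‖ ≤ 1) → |φ.eval A v| ≤ C := by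
  have key : ∀ {n : ℕ} (v : Fin n → A) (_ : ∀ i, ‖v i‖ ≤ 1)
      (x : Metric.closedBall (0 : A) 1), ∀ i, ‖(Fin.cons (x : A) v : Fin (n + 1) → A) i‖ ≤ 1 := by
    intro n v hv x i
    refine Fin.cases ?_ (fun j => ?_) i
    · exact mem_closedBall_zero_iff.1 x.2
    · simpa using hv j
  have ne : Nonempty (Metric.closedBall (0 : A) 1) := ⟨⟨0, by simp⟩⟩
  induction φ with
  | norm t =>
    obtain ⟨C, hC⟩ := t.exists_norm_eval_le A
    exact ⟨C, fun v hv => by simpa [Formula.eval] using hC v hv⟩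
  | conn f φ ih =>
    choose C hC using ih
    obtain ⟨D, hD⟩ := (isCompact_univ_pi fun j => isCompact_Icc (a := -C j) (b := C j)).bddAbove_image
      (f := fun y => |f y|) (by fun_prop)
    exact ⟨D, fun v hv => hD ⟨_, fun j _ => abs_le.1 (hC j v hv), rfl⟩⟩
  | sup φ ih =>
    obtain ⟨C, hC⟩ := ih
    refine ⟨C, fun v hv => abs_le.2 ⟨?_, ciSup_le fun x => (abs_le.1 (hC _ (key v hv x))).2⟩⟩
    obtain ⟨x⟩ := ne
    exact (abs_le.1 (hC _ (key v hv x))).1.trans (le_ciSup (f := fun x :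
      Metric.closedBall (0 : A) 1 => φ.eval A (Fin.cons (x : A) v))
      ⟨C, by rintro _ ⟨y, rfl⟩; exact (abs_le.1 (hC _ (key v hv y))).2⟩ x)
  | inf φ ih =>
    obtain ⟨C, hC⟩ := ih
    refine ⟨C, fun v hv => abs_le.2 ⟨le_ciInf fun x => (abs_le.1 (hC _ (key v hv x))).1, ?_⟩⟩
    obtain ⟨x⟩ := ne
    exact (ciInf_le (f := fun x :
      Metric.closedBall (0 : A) 1 => φ.eval A (Fin.cons (x : A) v))
      ⟨-C, by rintro _ ⟨y, rfl⟩; exact (abs_le.1 (hC _ (key v hv y))).1⟩ x).trans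
      (abs_le.1 (hC _ (key v hv x))).2

end CStarLogic

/-- A C⋆-algebra `A` is pseudocompact if every sentence of the language of C⋆-algebras whose value
is `0` in all finite-dimensional C⋆-algebras has value `0` in `A`. (Every finite-dimensional
C⋆-algebra is isomorphic to one in `Type`, so that it is enough to let `F` range over `Type`.) -/
def IsPseudocompact (A : Type u) [NonUnitalCStarAlgebra A] : Prop :=
  ∀ φ : CStarLogic.Sentence,
    (∀ (F : Type) [NonUnitalCStarAlgebra F] [FiniteDimensional ℂ F], φ.value F = 0) →
      φ.value A = 0

/-! ### The group `K₁` of a unital C⋆-algebra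

`K₁(A)` is the direct limit of the groups `Uₙ(A) / Uₙ(A)₀` under the maps induced by
`u ↦ diag(u, 1)`, where `Uₙ(A)` is the unitary group of `Mₙ(A)` and `Uₙ(A)₀` is the path component
of its identity. The norm topology of `Mₙ(A)` is the topology of entrywise convergence. -/

namespace KOne

variable (A : Type u) [CStarAlgebra A]

/-- The unitary group `Uₙ(A)` of `Mₙ(A)`. -/
abbrev U (n : ℕ) : Type u := unitary (Matrix (Fin n) (Fin n) A)

/-- The group `Uₙ(A) / Uₙ(A)₀` of homotopy classes of unitaries in `Mₙ(A)`. -/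
abbrev HomotopyClasses (n : ℕ) : Type u := U A n ⧸ Subgroup.pathComponentOne (U A n)

variable {A}

/-- The matrix `diag(x, 1)` of size `m ≥ n`, for a matrix `x` of size `n`. -/
def pad {n : ℕ} (m : ℕ) (x : Matrix (Fin n) (Fin n) A) : Matrix (Fin m) (Fin m) A :=
  fun i j => if h : (i : ℕ) < n ∧ (j : ℕ) < n then x ⟨i, h.1⟩ ⟨j, h.2⟩ else if i = j then 1 else 0

theorem pad_one (n m : ℕ) : pad m (1 : Matrix (Fin n) (Fin n) A) = 1 := by
  ext i j
  simp only [pad, Matrix.one_apply, Fin.ext_iff]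
  split_ifs <;> rfl

theorem pad_mul {n m : ℕ} (h : n ≤ m) (x y : Matrix (Fin n) (Fin n) A) :
    pad m (x * y) = pad m x * pad m y := by
  obtain ⟨k, rfl⟩ := Nat.exists_eq_add_of_le h
  have h₁ : ∀ (z : Matrix (Fin n) (Fin n) A) (a b : Fin n),
      pad (n + k) z (Fin.castAdd k a) (Fin.castAdd k b) = z a b := fun z a b => by simp [pad]
  have h₂ : ∀ (z : Matrix (Fin n) (Fin n) A) (a : Fin n) (b : Fin k),
      pad (n + k) z (Fin.castAdd k a) (Fin.natAdd n b) = 0 := fun z a b => by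
    have : (a : ℕ) ≠ n + b := by omega
    simp [pad, Fin.ext_iff, this]
  have h₃ : ∀ (z : Matrix (Fin n) (Fin n) A) (a : Fin k) (b : Fin n),
      pad (n + k) z (Fin.natAdd n a) (Fin.castAdd k b) = 0 := fun z a b => by
    have : n + (a : ℕ) ≠ b := by omega
    simp [pad, Fin.ext_iff, this]
  have h₄ : ∀ (z : Matrix (Fin n) (Fin n) A) (a b : Fin k),
      pad (n + k) z (Fin.natAdd n a) (Fin.natAdd n b) = if a = b then 1 else 0 := fun z a b => by
    simp [pad]
  ext i j
  rw [Matrix.mul_apply, Fin.sum_univ_add]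
  refine Fin.addCases (fun i => ?_) (fun i => ?_) i <;>
  refine Fin.addCases (fun j => ?_) (fun j => ?_) j <;>
  simp [h₁, h₂, h₃, h₄, Matrix.mul_apply]

theorem pad_star {n m : ℕ} (x : Matrix (Fin n) (Fin n) A) : pad m (star x) = star (pad m x) := by
  ext i j
  by_cases h : (i : ℕ) < n ∧ (j : ℕ) < n
  · simp [pad, Matrix.star_apply, h.1, h.2]
  · have h' : ¬((j : ℕ) < n ∧ (i : ℕ) < n) := fun h' => h ⟨h'.2, h'.1⟩
    simp only [pad, Matrix.star_apply, dif_neg h, dif_neg h', eq_comm (a := i)]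
    split_ifs <;> simp

theorem pad_pad {n m l : ℕ} (h' : n ≤ m) (x : Matrix (Fin n) (Fin n) A) :
    pad l (pad m x) = pad l x := by
  ext i j
  simp only [pad, Fin.ext_iff]
  split_ifs <;> first | rfl | omega

theorem pad_self {n : ℕ} (x : Matrix (Fin n) (Fin n) A) : pad n x = x := by
  ext i j
  simp [pad]

theorem continuous_pad (n m : ℕ) :
    Continuous (pad m : Matrix (Fin n) (Fin n) A → Matrix (Fin m) (Fin m) A) := by
  refine continuous_matrix fun i j => ?_
  simp only [pad]
  split_ifs <;> fun_prop

/-- The homomorphism `Uₙ(A) → Uₘ(A)`, `u ↦ diag(u, 1)`, for `n ≤ m`. -/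
def padHom {n m : ℕ} (h : n ≤ m) : U A n →* U A m where
  toFun u := ⟨pad m (u : Matrix (Fin n) (Fin n) A), by
    rw [Unitary.mem_iff, ← pad_star, ← pad_mul h, ← pad_mul h]
    simp [pad_one]⟩
  map_one' := Subtype.ext (pad_one n m)
  map_mul' u v := Subtype.ext (pad_mul h _ _)

/-- The homomorphism `Uₙ(A) / Uₙ(A)₀ → Uₘ(A) / Uₘ(A)₀` induced by `u ↦ diag(u, 1)`. -/
def transition (n m : ℕ) (h : n ≤ m) : HomotopyClasses A n →* HomotopyClasses A m :=
  QuotientGroup.map _ _ (padHom h) fun u hu => by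
    have hc : Continuous (padHom (A := A) h) :=
      ((continuous_pad n m).comp continuous_subtype_val).subtype_mk _
    have hj : Joined (1 : U A n) u := hu
    have := hj.map hc
    rw [map_one] at this
    exact this

instance directedSystem :
    DirectedSystem (HomotopyClasses A) fun n m h => ⇑(transition (A := A) n m h) where
  map_self n x := by
    induction x using QuotientGroup.induction_on with
    | H u => exact congrArg _ (Subtype.ext (pad_self _))
  map_map n m l h h' x := by
    induction x using QuotientGroup.induction_on with
    | H u => exact congrArg _ (Subtype.ext (pad_pad h _))

end KOne

/-- The group `K₁(A)` of a unital C⋆-algebra `A` (written multiplicatively). -/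
abbrev KOne (A : Type u) [CStarAlgebra A] : Type u :=
  DirectLimit (KOne.HomotopyClasses A) (KOne.transition (A := A))

noncomputable instance (A : Type u) [CStarAlgebra A] : Group (KOne A) := inferInstance

/-!
The proof transfers one family of sentences from finite-dimensional C⋆-algebras to `A`.

A finite-dimensional C⋆-algebra `F` is unital, by compactness of its unit ball and existence of an
approximate unit. Elements of `Mₙ(F)` have finite spectrum, so every function is continuous on the
spectrum; hence a unitary `v` of `Mₙ(F)` has a root `w` of order `k + 1`, obtained by dividing the
argument by `k + 1`, with `‖w - 1‖ ≤ π / (k + 1)` (`CStarAlgebra.exists_unitary_pow_eq`). An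
arbitrary matrix `u` with `‖star u * u - 1‖ < 1` is invertible, and is at distance at most
`‖star u * u - 1‖` from the unitary part of its polar decomposition
(`CStarAlgebra.exists_unitary_norm_sub_le`). So for every matrix `u` with entries in the unit ball
there is a unitary `w` near `1` whose power `w ^ (k + 1)` is at distance at most a constant times
`‖star u * u - 1‖` from `u`. With the norm of `Mₙ(F)` replaced by the sum of the norms of the
entries, and with the unit replaced by a variable `e` bound by an infimum, this is a sentence,
`CStarLogic.Formula.rootSentence`. Working with powers of `w` instead of a logarithm of `u` keeps
all terms polynomial and free of approximations.

A pseudocompact C⋆-algebra `A` satisfies these sentences. The approximate witnesses for `e` form a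
Cauchy sequence whose limit is a unit of `A`. For a unitary `u` of `Mₙ(A)` the sentence yields an
almost unitary `w` at distance little more than `1` from `1`, with `w ^ (k + 1)` close to `u`. The
unitary part `v` of `w` is at distance less than `2` from `1`, and `v ^ (k + 1)` is at distance less
than `2` from `u`; as unitaries at distance less than `2` are homotopic, so are `1` and `u`
(`CStarAlgebra.joined_one_of_norm_sub_pow_le`). For `n = 1` this is the claim on the unitary group
of `A`, and for all `n` together it shows that `K₁(A)` is trivial.
-/

/-! ### Terms and matrices of terms -/

namespace CStarLogic

namespace Term

/-- The difference of two terms. -/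
def sub {m : ℕ} (s t : Term m) : Term m := .add s (.smul (-1) t)

/-- The sum of a finite family of terms. -/
def sum {m : ℕ} : (n : ℕ) → (Fin n → Term m) → Term m
  | 0, _ => .zero
  | n + 1, t => .add (t 0) (Term.sum n fun i => t i.succ)

variable {A : Type u} [NonUnitalCStarAlgebra A] {m n : ℕ}

theorem eval_sub (s t : Term m) (v : Fin m → A) :
    (s.sub t).eval A v = s.eval A v - t.eval A v := by
  simp [sub, eval, sub_eq_add_neg]

theorem eval_sum (t : Fin n → Term m) (v : Fin m → A) :
    (Term.sum n t).eval A v = ∑ i, (t i).eval A v := by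
  induction n with
  | zero => simp [sum, eval]
  | succ n ih => rw [Fin.sum_univ_succ, sum, eval, ih]

end Term

/-- An `n × n` matrix of terms, standing for an element of `Mₙ(A)` that depends on `m` variables
in `A`. -/
abbrev MatrixTerm (n m : ℕ) : Type := Fin n → Fin n → Term m

namespace MatrixTerm

variable {m n : ℕ}

/-- The value of a matrix of terms, as an element of the C⋆-algebra `Mₙ(A)`. -/
def eval (A : Type u) [NonUnitalCStarAlgebra A] (s : MatrixTerm n m) (v : Fin m → A) :
    CStarMatrix (Fin n) (Fin n) A :=
  CStarMatrix.ofMatrix fun i j => (s i j).eval A v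

/-- The difference of two matrices of terms. -/
def sub (s t : MatrixTerm n m) : MatrixTerm n m := fun i j => (s i j).sub (t i j)

/-- The product of two matrices of terms. -/
def mul (s t : MatrixTerm n m) : MatrixTerm n m :=
  fun i j => Term.sum n fun l => .mul (s i l) (t l j)

/-- The adjoint of a matrix of terms. -/
def star (s : MatrixTerm n m) : MatrixTerm n m := fun i j => .star (s j i)

/-- The diagonal matrix with all diagonal entries equal to `t`. -/
def scalar (n : ℕ) (t : Term m) : MatrixTerm n m := fun i j => if i = j then t else .zero

/-- The power `s ^ (k + 1)`. The exponent is shifted because there is no term for the unit. -/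
def powSucc (s : MatrixTerm n m) : ℕ → MatrixTerm n m
  | 0 => s
  | k + 1 => (s.powSucc k).mul s

/-- The formula for the sum of the norms of the entries of a matrix of terms. -/
def entrySum (s : MatrixTerm n m) : Formula m :=
  .conn ⟨fun y => ∑ i, y i, by fun_prop⟩ fun i =>
    .conn ⟨fun y => ∑ j, y j, by fun_prop⟩ fun j => .norm (s i j)

section

variable {A : Type u} [NonUnitalCStarAlgebra A] (s t : MatrixTerm n m) (v : Fin m → A)

theorem eval_sub : (s.sub t).eval A v = s.eval A v - t.eval A v := by
  ext i j
  exact Term.eval_sub (s i j) (t i j) v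

theorem eval_mul : (s.mul t).eval A v = s.eval A v * t.eval A v := by
  ext i j
  exact Term.eval_sum _ v

theorem eval_star : s.star.eval A v = Star.star (s.eval A v) := by
  ext i j
  rfl

theorem eval_entrySum : s.entrySum.eval A v = ∑ i, ∑ j, ‖s.eval A v i j‖ := rfl

end

variable {A : Type u} [CStarAlgebra A] (s : MatrixTerm n m) (v : Fin m → A)

theorem eval_powSucc (k : ℕ) : (s.powSucc k).eval A v = s.eval A v ^ (k + 1) := by
  induction k with
  | zero => rw [zero_add, pow_one]; rfl
  | succ k ih =>
    rw [pow_succ, ← ih]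
    exact eval_mul _ _ v

theorem eval_scalar (t : Term m) :
    (scalar n t).eval A v = CStarMatrix.ofMatrix (Matrix.diagonal fun _ => t.eval A v) := by
  ext i j
  change (if i = j then t else Term.zero).eval A v = Matrix.diagonal (fun _ => t.eval A v) i j
  rw [Matrix.diagonal_apply]
  split_ifs <;> rfl

end MatrixTerm

/-! ### Blocks of quantifiers -/

/-- The assignment that puts the `k` values `x` before the `m` values `v`, in the order in which
nested quantifiers bind them. -/
def prepend {A : Type u} {m : ℕ} (k : ℕ) (x : Fin k → A) (v : Fin m → A) : Fin (m + k) → A :=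
  fun i => if h : (i : ℕ) < k then x ⟨i, h⟩ else v ⟨i - k, by omega⟩

theorem prepend_succ {A : Type u} {m k : ℕ} (x : Fin (k + 1) → A) (v : Fin m → A) :
    prepend (k + 1) x v =
      (Fin.cons (x 0) (prepend k (fun i => x i.succ) v) : Fin (m + k + 1) → A) := by
  funext i
  refine Fin.cases rfl (fun i => ?_) i
  rw [Fin.cons_succ]
  simp [prepend, Nat.add_sub_add_right]

theorem norm_prepend_le {A : Type u} [NonUnitalCStarAlgebra A] {m k : ℕ} {x : Fin k → A}
    {v : Fin m → A} (hx : ∀ i, ‖x i‖ ≤ 1) (hv : ∀ i, ‖v i‖ ≤ 1) (i : Fin (m + k)) :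
    ‖prepend k x v i‖ ≤ 1 := by
  unfold prepend
  split_ifs
  exacts [hx _, hv _]

theorem norm_cons_le {A : Type u} [NonUnitalCStarAlgebra A] {m : ℕ} {x : A}
    {v : Fin m → A} (hx : ‖x‖ ≤ 1) (hv : ∀ i, ‖v i‖ ≤ 1) (i : Fin (m + 1)) :
    ‖(Fin.cons x v : Fin (m + 1) → A) i‖ ≤ 1 :=
  Fin.cases hx hv i

namespace Formula

/-- The maximum of two formulas. -/
def max {m : ℕ} (φ ψ : Formula m) : Formula m :=
  .conn ⟨fun y : Fin 2 → ℝ => y 0 ⊔ y 1, by fun_prop⟩ ![φ, ψ]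

/-- The formula `φ - c * ψ`. -/
def subMul {m : ℕ} (φ : Formula m) (c : ℝ) (ψ : Formula m) : Formula m :=
  .conn ⟨fun y : Fin 2 → ℝ => y 0 - c * y 1, by fun_prop⟩ ![φ, ψ]

/-- The formula with the constant value `c`. -/
def const {m : ℕ} (c : ℝ) : Formula m :=
  .conn ⟨fun _ : Fin 0 → ℝ => c, by fun_prop⟩ ![]

/-- The supremum over `k` variables in the unit ball. -/
def sups {m : ℕ} : (k : ℕ) → Formula (m + k) → Formula m
  | 0, φ => φ
  | k + 1, φ => sups k (.sup (n := m + k) φ)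

/-- The infimum over `k` variables in the unit ball. -/
def infs {m : ℕ} : (k : ℕ) → Formula (m + k) → Formula m
  | 0, φ => φ
  | k + 1, φ => infs k (.inf (n := m + k) φ)

variable {A : Type u} [NonUnitalCStarAlgebra A] {m : ℕ}

theorem eval_max (φ ψ : Formula m) (v : Fin m → A) :
    (φ.max ψ).eval A v = φ.eval A v ⊔ ψ.eval A v := rfl

theorem eval_subMul (φ : Formula m) (c : ℝ) (ψ : Formula m) (v : Fin m → A) :
    (φ.subMul c ψ).eval A v = φ.eval A v - c * ψ.eval A v := rfl

theorem eval_const (c : ℝ) (v : Fin m → A) : (const c : Formula m).eval A v = c := rfl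

theorem eval_norm (t : Term m) (v : Fin m → A) : (norm t).eval A v = ‖t.eval A v‖ := rfl

theorem eval_sup_le {φ : Formula (m + 1)} {v : Fin m → A} {c : ℝ}
    (h : ∀ x : A, ‖x‖ ≤ 1 → φ.eval A (Fin.cons x v) ≤ c) : (sup φ).eval A v ≤ c :=
  have : Nonempty (Metric.closedBall (0 : A) 1) := ⟨⟨0, by simp⟩⟩
  ciSup_le fun x => h x (mem_closedBall_zero_iff.1 x.2)

theorem le_eval_sup (φ : Formula (m + 1)) {v : Fin m → A} (hv : ∀ i, ‖v i‖ ≤ 1) {x : A}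
    (hx : ‖x‖ ≤ 1) : φ.eval A (Fin.cons x v) ≤ (sup φ).eval A v := by
  obtain ⟨C, hC⟩ := φ.exists_abs_eval_le A
  refine le_ciSup (f := fun x : Metric.closedBall (0 : A) 1 => φ.eval A (Fin.cons (x : A) v))
    ⟨C, ?_⟩ ⟨x, mem_closedBall_zero_iff.2 hx⟩
  rintro _ ⟨y, rfl⟩
  exact (abs_le.1 (hC _ (norm_cons_le (mem_closedBall_zero_iff.1 y.2) hv))).2

theorem eval_inf_le (φ : Formula (m + 1)) {v : Fin m → A} (hv : ∀ i, ‖v i‖ ≤ 1) {x : A}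
    (hx : ‖x‖ ≤ 1) : (inf φ).eval A v ≤ φ.eval A (Fin.cons x v) := by
  obtain ⟨C, hC⟩ := φ.exists_abs_eval_le A
  refine ciInf_le (f := fun x : Metric.closedBall (0 : A) 1 => φ.eval A (Fin.cons (x : A) v))
    ⟨-C, ?_⟩ ⟨x, mem_closedBall_zero_iff.2 hx⟩
  rintro _ ⟨y, rfl⟩
  exact (abs_le.1 (hC _ (norm_cons_le (mem_closedBall_zero_iff.1 y.2) hv))).1

theorem exists_of_eval_inf_lt {φ : Formula (m + 1)} {v : Fin m → A} {c : ℝ}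
    (h : (inf φ).eval A v < c) : ∃ x : A, ‖x‖ ≤ 1 ∧ φ.eval A (Fin.cons x v) < c := by
  have : Nonempty (Metric.closedBall (0 : A) 1) := ⟨⟨0, by simp⟩⟩
  obtain ⟨x, hx⟩ := exists_lt_of_ciInf_lt h
  exact ⟨x, mem_closedBall_zero_iff.1 x.2, hx⟩

theorem eval_sups_le {k : ℕ} {φ : Formula (m + k)} {v : Fin m → A} {c : ℝ}
    (h : ∀ x : Fin k → A, (∀ i, ‖x i‖ ≤ 1) → φ.eval A (prepend k x v) ≤ c) :
    (sups k φ).eval A v ≤ c := by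
  induction k with
  | zero => exact h Fin.elim0 fun i => i.elim0
  | succ k ih =>
    refine ih fun x hx => eval_sup_le fun y hy => ?_
    have := h (Fin.cons y x) (norm_cons_le hy hx)
    rwa [prepend_succ] at this

theorem le_eval_sups {k : ℕ} (φ : Formula (m + k)) {v : Fin m → A} (hv : ∀ i, ‖v i‖ ≤ 1)
    {x : Fin k → A} (hx : ∀ i, ‖x i‖ ≤ 1) : φ.eval A (prepend k x v) ≤ (sups k φ).eval A v := by
  induction k with
  | zero => exact le_rfl
  | succ k ih =>
    rw [prepend_succ]
    exact (le_eval_sup φ (norm_prepend_le (fun i => hx i.succ) hv) (hx 0)).trans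
      (ih (.sup (n := m + k) φ) fun i => hx i.succ)

theorem eval_infs_le {k : ℕ} (φ : Formula (m + k)) {v : Fin m → A} (hv : ∀ i, ‖v i‖ ≤ 1)
    {x : Fin k → A} (hx : ∀ i, ‖x i‖ ≤ 1) : (infs k φ).eval A v ≤ φ.eval A (prepend k x v) := by
  induction k with
  | zero => exact le_rfl
  | succ k ih =>
    rw [prepend_succ]
    exact (ih (.inf (n := m + k) φ) fun i => hx i.succ).trans
      (eval_inf_le φ (norm_prepend_le (fun i => hx i.succ) hv) (hx 0))

theorem exists_of_eval_infs_lt {k : ℕ} {φ : Formula (m + k)} {v : Fin m → A} {c : ℝ}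
    (h : (infs k φ).eval A v < c) :
    ∃ x : Fin k → A, (∀ i, ‖x i‖ ≤ 1) ∧ φ.eval A (prepend k x v) < c := by
  induction k with
  | zero => exact ⟨Fin.elim0, fun i => i.elim0, h⟩
  | succ k ih =>
    obtain ⟨x, hx, hx'⟩ := ih (φ := .inf (n := m + k) φ) h
    obtain ⟨y, hy, hy'⟩ := exists_of_eval_inf_lt hx'
    exact ⟨Fin.cons y x, norm_cons_le hy hx, by rwa [prepend_succ]⟩

end Formula

end CStarLogic

/-! ### Units of C⋆-algebras -/

/-- A C⋆-algebra that has a unit as a ring is a unital C⋆-algebra. -/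
theorem NonUnitalCStarAlgebra.exists_cstarAlgebra {A : Type u} [inst₀ : NonUnitalCStarAlgebra A]
    (e : A) (he : ∀ y, e * y = y) (he' : ∀ y, y * e = y) :
    ∃ inst : CStarAlgebra A, inst.toNonUnitalCStarAlgebra = inst₀ := by
  let : NormedRing A :=
    { (inferInstance : NonUnitalNormedRing A) with
      one := e
      one_mul := he
      mul_one := he' }
  let : NormedAlgebra ℂ A :=
    { Algebra.ofModule (R := ℂ) (A := A) (fun c x y => smul_mul_assoc c x y)
        (fun c x y => mul_smul_comm c x y) with
      norm_smul_le := norm_smul_le }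
  exact ⟨{ }, rfl⟩

theorem CStarAlgebra.norm_one_le (A : Type u) [CStarAlgebra A] : ‖(1 : A)‖ ≤ 1 := by
  nontriviality A
  exact norm_one.le

open Filter Topology in
theorem NonUnitalCStarAlgebra.exists_unit_of_finiteDimensional (F : Type u)
    [NonUnitalCStarAlgebra F] [FiniteDimensional ℂ F] :
    ∃ e : F, (∀ y, e * y = y) ∧ ∀ y, y * e = y := by
  let := CStarAlgebra.spectralOrder F
  have := CStarAlgebra.spectralOrderedRing F
  have : ProperSpace F := FiniteDimensional.proper ℂ F
  have h := CStarAlgebra.increasingApproximateUnit F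
  have := h.neBot
  obtain ⟨e, -, he⟩ := (isCompact_closedBall (0 : F) 1).exists_clusterPt
    (le_principal_iff.2 h.closedBall_mem)
  -- The unit is a cluster point of an approximate unit.
  have key : ∀ f : F → F, Continuous f → ∀ y, Tendsto f (CStarAlgebra.approximateUnit F) (𝓝 y) →
      f e = y := fun f hf y hy => by
    have h₁ : ClusterPt (f e) (map f (CStarAlgebra.approximateUnit F)) :=
      he.map hf.continuousAt tendsto_map
    have h₂ : (𝓝 (f e) ⊓ 𝓝 y).NeBot := h₁.mono hy
    exact eq_of_nhds_neBot h₂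
  exact ⟨e, fun y => key (fun x => x * y) (by fun_prop) y (h.tendsto_mul_right y),
    fun y => key (fun x => y * x) (by fun_prop) y (h.tendsto_mul_left y)⟩

open Filter Topology in
theorem NonUnitalCStarAlgebra.exists_unit_of_forall_exists_norm_sub_le {A : Type u}
    [NonUnitalCStarAlgebra A]
    (h : ∀ ε : ℝ, 0 < ε → ∃ e : A, ‖e‖ ≤ 1 ∧
      ∀ y : A, ‖y‖ ≤ 1 → ‖e * y - y‖ ≤ ε ∧ ‖y * e - y‖ ≤ ε) :
    ∃ e : A, (∀ y, e * y = y) ∧ ∀ y, y * e = y := by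
  choose e he₁ he using fun n : ℕ => h (1 / (n + 1)) (by positivity)
  have hlim : Tendsto (fun n : ℕ => (1 : ℝ) / (n + 1)) atTop (𝓝 0) :=
    tendsto_one_div_add_atTop_nhds_zero_nat
  have hcauchy : CauchySeq e := by
    refine cauchySeq_of_le_tendsto_0 (fun n : ℕ => 1 / (n + 1) + 1 / (n + 1))
      (fun m n N hm hn => ?_) (by simpa using hlim.add hlim)
    have h₁ := (he m (e n) (he₁ n)).1
    have h₂ := (he n (e m) (he₁ m)).2
    have h₃ : e m - e n = (e m * e n - e n) - (e m * e n - e m) := by abel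
    rw [dist_eq_norm, h₃]
    refine (norm_sub_le _ _).trans (add_le_add (h₁.trans ?_) (h₂.trans ?_)) <;> gcongr
  obtain ⟨e₀, he₀⟩ := cauchySeq_tendsto_of_complete hcauchy
  have hball : ∀ y : A, ‖y‖ ≤ 1 → e₀ * y = y ∧ y * e₀ = y := fun y hy =>
    ⟨tendsto_nhds_unique (he₀.mul_const y) (tendsto_iff_norm_sub_tendsto_zero.2
        (squeeze_zero (fun _ => norm_nonneg _) (fun n => (he n y hy).1) hlim)),
      tendsto_nhds_unique (he₀.const_mul y) (tendsto_iff_norm_sub_tendsto_zero.2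
        (squeeze_zero (fun _ => norm_nonneg _) (fun n => (he n y hy).2) hlim))⟩
  have hscale : ∀ y : A, ∃ c : ℂ, ∃ z : A, ‖z‖ ≤ 1 ∧ y = c • z := fun y => by
    rcases eq_or_ne y 0 with rfl | hy
    · exact ⟨0, 0, by simp, by simp⟩
    · have hy' : (‖y‖ : ℂ) ≠ 0 := by exact_mod_cast norm_ne_zero_iff.2 hy
      refine ⟨‖y‖, (‖y‖ : ℂ)⁻¹ • y, ?_, (smul_inv_smul₀ hy' y).symm⟩
      rw [norm_smul, norm_inv, Complex.norm_real, norm_norm,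
        inv_mul_cancel₀ (norm_ne_zero_iff.2 hy)]
  refine ⟨e₀, fun y => ?_, fun y => ?_⟩ <;> obtain ⟨c, z, hz, rfl⟩ := hscale y
  · rw [mul_smul_comm, (hball z hz).1]
  · rw [smul_mul_assoc, (hball z hz).2]

/-! ### Approximately unitary elements -/

section

variable {B : Type u} [CStarAlgebra B]

/-- An invertible element `x` is at distance at most `‖star x * x - 1‖` from a unitary, namely
from the unitary part of its polar decomposition. -/
theorem CStarAlgebra.exists_unitary_norm_sub_le {x : B} (hx : IsUnit x)
    (h : ‖star x * x - 1‖ < 1) :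
    ∃ v : unitary B, ‖x - v‖ ≤ ‖star x * x - 1‖ := by
  nontriviality B
  set a := star x * x with ha
  have hsa : IsSelfAdjoint a := .star_mul_self x
  have hspec : ∀ t ∈ spectrum ℝ a, |t - 1| ≤ ‖a - 1‖ := fun t ht => by
    have : t - 1 ∈ spectrum ℝ (a - 1) := by
      have := spectrum.sub_singleton_eq a (1 : ℝ)
      rw [map_one] at this
      exact this ▸ Set.sub_mem_sub ht rfl
    simpa using spectrum.norm_le_norm_of_mem this
  have hpos : ∀ t ∈ spectrum ℝ a, 0 < t := fun t ht => by
    have := (abs_lt.1 ((hspec t ht).trans_lt h)).1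
    linarith
  have hc : ContinuousOn (fun t : ℝ => (√t)⁻¹) (spectrum ℝ a) :=
    Real.continuous_sqrt.continuousOn.inv₀ fun t ht => (Real.sqrt_pos.2 (hpos t ht)).ne'
  have hc' : ContinuousOn (fun t : ℝ => √t) (spectrum ℝ a) := Real.continuous_sqrt.continuousOn
  set g := cfc (fun t : ℝ => (√t)⁻¹) a with hg
  set s := cfc (fun t : ℝ => √t) a with hs
  have hgs : g * s = 1 := by
    rw [hg, hs, ← cfc_mul _ _ a hc hc', ← cfc_one ℝ a]
    exact cfc_congr fun t ht => inv_mul_cancel₀ (Real.sqrt_pos.2 (hpos t ht)).ne'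
  have hsg : s * g = 1 := by
    rw [hg, hs, ← cfc_mul _ _ a hc' hc, ← cfc_one ℝ a]
    exact cfc_congr fun t ht => mul_inv_cancel₀ (Real.sqrt_pos.2 (hpos t ht)).ne'
  have hss : s * s = a := by
    rw [hs, ← cfc_mul _ _ a hc' hc']
    conv_rhs => rw [← cfc_id' ℝ a]
    exact cfc_congr fun t ht => Real.mul_self_sqrt (hpos t ht).le
  have hgstar : star g = g := (cfc_predicate (fun t : ℝ => (√t)⁻¹) a : IsSelfAdjoint g)
  have hv : star (x * g) * (x * g) = 1 := by
    rw [star_mul, hgstar, mul_assoc, ← mul_assoc (star x), ← ha, ← hss, mul_assoc s, hsg, mul_one,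
      hgs]
  have hvu : IsUnit (x * g) := hx.mul (isUnit_iff_exists.2 ⟨s, hgs, hsg⟩)
  have hv' : (x * g) * star (x * g) = 1 := by
    obtain ⟨y, hy⟩ := hvu.exists_right_inv
    rwa [left_inv_eq_right_inv hv hy]
  refine ⟨⟨x * g, Unitary.mem_iff.2 ⟨hv, hv'⟩⟩, ?_⟩
  have : x - x * g = x * g * (s - 1) := by rw [mul_sub, mul_assoc x, hgs, mul_one, mul_one]
  change ‖x - x * g‖ ≤ _
  rw [this, CStarRing.norm_mem_unitary_mul _ (Unitary.mem_iff.2 ⟨hv, hv'⟩), hs, ← cfc_const_one ℝ a,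
    ← cfc_sub _ _ a hc' continuousOn_const, cfc_const_one ℝ a]
  refine norm_cfc_le (norm_nonneg _) fun t ht => ?_
  -- `t - 1 = (√t - 1) * (√t + 1)`
  have h₀ := Real.sqrt_nonneg t
  have h₁ : t - 1 = (√t - 1) * (√t + 1) := by
    nlinarith [Real.mul_self_sqrt (hpos t ht).le]
  have h₂ : |√t - 1| ≤ |t - 1| := by
    rw [h₁, abs_mul, abs_of_nonneg (by positivity : 0 ≤ √t + 1)]
    nlinarith [abs_nonneg (√t - 1)]
  simpa using h₂.trans (by simpa using hspec t ht)

/-- A unitary with finite spectrum has roots of every order, and those obtained from the principal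
argument are close to `1`. -/
theorem CStarAlgebra.exists_unitary_pow_eq {v : B} (hv : v ∈ unitary B)
    (hfin : (spectrum ℂ v).Finite) (k : ℕ) :
    ∃ w ∈ unitary B, w ^ (k + 1) = v ∧ ‖w - 1‖ ≤ Real.pi / (k + 1) := by
  have : IsStarNormal v := by
    rw [isStarNormal_iff, commute_iff_eq, Unitary.star_mul_self_of_mem hv,
      Unitary.mul_star_self_of_mem hv]
  set f : ℂ → ℂ := fun z => Complex.exp ((z.arg / (k + 1) : ℝ) * Complex.I)
  have hf : ContinuousOn f (spectrum ℂ v) := hfin.continuousOn _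
  refine ⟨cfc f v, ?_, ?_, ?_⟩
  · rw [cfc_unitary_iff f v]
    intro z _
    rw [Complex.star_def, ← Complex.normSq_eq_conj_mul_self, Complex.normSq_eq_norm_sq,
      Complex.norm_exp_ofReal_mul_I]
    simp
  · rw [← cfc_pow f (k + 1) v]
    conv_rhs => rw [← cfc_id' ℂ v]
    refine cfc_congr fun z hz => ?_
    have hz₁ : ‖z‖ = 1 := spectrum.norm_eq_one_of_unitary hv hz
    have hk : (k + 1 : ℂ) ≠ 0 := by exact_mod_cast k.succ_ne_zero
    rw [← Complex.exp_nat_mul]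
    conv_rhs => rw [← Complex.norm_mul_exp_arg_mul_I z, hz₁]
    push_cast
    rw [one_mul]
    congr 1
    field_simp
  · rw [← cfc_const_one ℂ v, ← cfc_sub f _ v hf continuousOn_const]
    refine norm_cfc_le (by positivity) fun z _ => ?_
    have h₁ := Real.norm_exp_I_mul_ofReal_sub_one_le (x := z.arg / (k + 1))
    rw [mul_comm] at h₁
    refine h₁.trans ?_
    rw [Real.norm_eq_abs, abs_div, abs_of_pos (by positivity : (0 : ℝ) < k + 1)]
    gcongr
    exact Complex.abs_arg_le_pi z

theorem CStarAlgebra.norm_pow_sub_pow_le {a b : B} (ha : ‖a‖ ≤ 2) (hb : b ∈ unitary B) (k : ℕ) :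
    ‖a ^ k - b ^ k‖ ≤ (2 ^ k - 1) * ‖a - b‖ := by
  induction k with
  | zero => simp
  | succ k ih =>
    have h₁ : a ^ (k + 1) - b ^ (k + 1) = a * (a ^ k - b ^ k) + (a - b) * b ^ k := by
      rw [pow_succ' a, pow_succ' b]; noncomm_ring
    have h₂ := norm_mul_le_of_le ha ih
    have h₃ : ‖(a - b) * b ^ k‖ = ‖a - b‖ := CStarRing.norm_mul_mem_unitary _ (pow_mem hb k)
    rw [h₁]
    refine (norm_add_le _ _).trans ((add_le_add h₂ h₃.le).trans_eq ?_)
    ring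

theorem IsUnit.of_star_mul_self_of_self_mul_star {x : B} (h₁ : IsUnit (star x * x))
    (h₂ : IsUnit (x * star x)) : IsUnit x := by
  obtain ⟨y, hy⟩ := h₁.exists_left_inv
  obtain ⟨z, hz⟩ := h₂.exists_right_inv
  rw [← mul_assoc] at hy
  rw [mul_assoc] at hz
  exact isUnit_iff_exists.2 ⟨_, hz, left_inv_eq_right_inv hy hz ▸ hy⟩

/-- If a unitary `u` is close to a power of an almost unitary element `w`, and the distance of `w`
from `1` is not much more than `1`, then `u` is homotopic to `1`: the unitary part `v` of `w` is
homotopic to `1`, and `u` is close to a power of `v`. -/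
theorem CStarAlgebra.joined_one_of_norm_sub_pow_le {u : unitary B} {w : B} {k : ℕ} {δ : ℝ}
    (hδ : δ ≤ 1 / 4) (hkδ : 2 ^ k * δ ≤ 1) (h₀ : ‖w - 1‖ ≤ 1 + δ) (h₁ : ‖star w * w - 1‖ ≤ δ)
    (h₂ : ‖w * star w - 1‖ ≤ δ) (h₃ : ‖(u : B) - w ^ k‖ ≤ δ) : Joined 1 u := by
  have hw : IsUnit w := by
    refine .of_star_mul_self_of_self_mul_star ?_ ?_ <;>
      refine ?_
    · rw [← sub_sub_cancel 1 (star w * w)]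
      exact isUnit_one_sub_of_norm_lt_one (by rw [norm_sub_rev]; linarith)
    · rw [← sub_sub_cancel 1 (w * star w)]
      exact isUnit_one_sub_of_norm_lt_one (by rw [norm_sub_rev]; linarith)
  obtain ⟨v, hv⟩ := exists_unitary_norm_sub_le hw (by linarith)
  replace hv := hv.trans h₁
  have hwn : ‖w‖ ≤ 2 := by
    have := norm_le_norm_add_norm_sub' (star w * w) 1
    rw [CStarRing.norm_star_mul_self] at this
    nlinarith [norm_one_le B]
  have hpow := norm_pow_sub_pow_le hwn v.2 k
  have h1v : Joined 1 v := Unitary.joined _ _ <| by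
    have : (v : B) - 1 = (w - 1) - (w - v) := by abel
    have h := norm_sub_le (w - 1) (w - v)
    rw [OneMemClass.coe_one, this]
    linarith
  have hvu : Joined (v ^ k) u := Unitary.joined _ _ <| by
    have : (u : B) - (v : B) ^ k = (u - w ^ k) + (w ^ k - (v : B) ^ k) := by abel
    have h := norm_add_le ((u : B) - w ^ k) (w ^ k - (v : B) ^ k)
    have h' : (2 ^ k - 1) * ‖w - v‖ ≤ 2 ^ k * δ := by
      nlinarith [norm_nonneg (w - v), one_le_pow₀ (one_le_two : (1 : ℝ) ≤ 2) (n := k)]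
    rw [SubmonoidClass.coe_pow, this]
    linarith
  have := h1v.map (continuous_pow k)
  rw [one_pow] at this
  exact this.trans hvu

end

section

variable {B : Type u} [CStarAlgebra B] [FiniteDimensional ℂ B]

theorem CStarAlgebra.finite_spectrum_of_finiteDimensional (v : B) : (spectrum ℂ v).Finite := by
  nontriviality B
  have hv : IsIntegral ℂ v := IsIntegral.of_finite ℂ v
  refine (Polynomial.finite_setOfPred_isRoot (minpoly.ne_zero hv)).subset fun z hz => ?_
  have h := spectrum.subset_polynomial_aeval v (minpoly ℂ v) ⟨z, hz, rfl⟩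
  simpa [minpoly.aeval, spectrum.zero_eq] using h

theorem CStarAlgebra.isUnit_of_isUnit_mul_of_finiteDimensional {x y : B} (h : IsUnit (y * x)) :
    IsUnit x := by
  obtain ⟨z, hz⟩ := h.exists_left_inv
  rw [← mul_assoc] at hz
  have hinj : Function.Injective (LinearMap.mulLeft ℂ x) := fun a b hab => by
    have : z * y * (x * a) = z * y * (x * b) := congrArg _ hab
    simpa [← mul_assoc, hz] using this
  obtain ⟨t, ht⟩ := LinearMap.surjective_of_injective hinj 1
  have ht : x * t = 1 := ht
  exact isUnit_iff_exists.2 ⟨t, ht, left_inv_eq_right_inv hz ht ▸ hz⟩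

/-- In a finite-dimensional C⋆-algebra every almost unitary element is close to a power of a
unitary that is itself close to `1`. -/
theorem CStarAlgebra.exists_unitary_norm_sub_pow_le {x : B} (h : ‖star x * x - 1‖ < 1) (k : ℕ) :
    ∃ w ∈ unitary B, ‖x - w ^ (k + 1)‖ ≤ ‖star x * x - 1‖ ∧ ‖w - 1‖ ≤ Real.pi / (k + 1) := by
  have hx : IsUnit (star x * x) := by
    rw [← sub_sub_cancel 1 (star x * x)]
    exact isUnit_one_sub_of_norm_lt_one (by rwa [norm_sub_rev])
  obtain ⟨v, hv⟩ :=
    exists_unitary_norm_sub_le (isUnit_of_isUnit_mul_of_finiteDimensional hx) h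
  obtain ⟨w, hw, hwv, hw₁⟩ :=
    exists_unitary_pow_eq v.2 (finite_spectrum_of_finiteDimensional (v : B)) k
  exact ⟨w, hw, hwv ▸ hv, hw₁⟩

end

/-! ### The sum of the norms of the entries of a matrix -/

namespace CStarMatrix

variable {A : Type u} [NonUnitalCStarAlgebra A] {n : ℕ}

/-- The sum of the norms of the entries of a matrix, a norm equivalent to the norm of `Mₙ(A)` which,
unlike the latter, is given by a formula in the entries. -/
noncomputable def entrySum (x : CStarMatrix (Fin n) (Fin n) A) : ℝ := ∑ i, ∑ j, ‖x i j‖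

theorem entrySum_nonneg (x : CStarMatrix (Fin n) (Fin n) A) : 0 ≤ entrySum x :=
  Finset.sum_nonneg fun _ _ => Finset.sum_nonneg fun _ _ => norm_nonneg _

theorem entrySum_zero : entrySum (0 : CStarMatrix (Fin n) (Fin n) A) = 0 := by
  simp [entrySum]

theorem entrySum_le_of_forall_le {x : CStarMatrix (Fin n) (Fin n) A} {c : ℝ}
    (h : ∀ i j, ‖x i j‖ ≤ c) : entrySum x ≤ n * n * c := by
  refine (Finset.sum_le_sum fun i _ => Finset.sum_le_sum fun j _ => h i j).trans_eq ?_
  simp [mul_assoc]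

variable [PartialOrder A] [StarOrderedRing A]

theorem entrySum_le (x : CStarMatrix (Fin n) (Fin n) A) : entrySum x ≤ n * n * ‖x‖ :=
  entrySum_le_of_forall_le fun _ _ => norm_entry_le_norm

theorem norm_le_entrySum (x : CStarMatrix (Fin n) (Fin n) A) : ‖x‖ ≤ entrySum x := by
  rw [norm_def, entrySum, Finset.sum_comm]
  refine (toCLM x).opNorm_le_bound
    (Finset.sum_nonneg fun _ _ => Finset.sum_nonneg fun _ _ => norm_nonneg _) fun v => ?_
  simp only [toCLM_apply_eq_sum, Finset.sum_mul]
  apply WithCStarModule.pi_norm_le_sum_norm _ |>.trans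
  gcongr with i _
  change ‖∑ j, v j * x j i‖ ≤ _
  apply norm_sum_le _ _ |>.trans
  gcongr with j _
  apply norm_mul_le _ _ |>.trans
  rw [mul_comm]
  gcongr
  exact WithCStarModule.norm_apply_le_norm v j

end CStarMatrix

namespace CStarMatrix

variable {A : Type u} [CStarAlgebra A] [PartialOrder A] [StarOrderedRing A] {n : ℕ}

theorem norm_ofMatrix_diagonal_sub_one_le (e : A) :
    ‖ofMatrix (Matrix.diagonal fun _ : Fin n => e) - 1‖ ≤ n * ‖e - 1‖ := by
  refine (norm_le_entrySum _).trans_eq ?_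
  have h : ∀ i j : Fin n, ‖(ofMatrix (Matrix.diagonal fun _ : Fin n => e) - 1) i j‖ =
      if i = j then ‖e - 1‖ else 0 := fun i j => by
    change ‖Matrix.diagonal (fun _ : Fin n => e) i j - (1 : Matrix (Fin n) (Fin n) A) i j‖ = _
    rw [Matrix.diagonal_apply, Matrix.one_apply]
    split_ifs <;> simp
  simp only [entrySum, h]
  simp

omit [PartialOrder A] [StarOrderedRing A] in
theorem ofMatrix_diagonal_one :
    ofMatrix (Matrix.diagonal fun _ : Fin n => (1 : A)) = 1 := rfl

instance [FiniteDimensional ℂ A] : FiniteDimensional ℂ (CStarMatrix (Fin n) (Fin n) A) :=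
  inferInstanceAs (FiniteDimensional ℂ (Matrix (Fin n) (Fin n) A))

end CStarMatrix

/-! ### The sentence on roots of almost unitary matrices -/

namespace CStarLogic

/-- The position of the `i`-th new variable in an assignment formed with `prepend`. -/
def newVar {m : ℕ} (k : ℕ) (i : Fin k) : Fin (m + k) := ⟨i, by omega⟩

/-- The position of the `i`-th old variable in an assignment formed with `prepend`. -/
def oldVar {m : ℕ} (k : ℕ) (i : Fin m) : Fin (m + k) := ⟨k + i, by omega⟩

theorem prepend_newVar {A : Type u} {m k : ℕ} (x : Fin k → A) (v : Fin m → A) (i : Fin k) :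
    prepend k x v (newVar k i) = x i := by
  simp [prepend, newVar]

theorem prepend_oldVar {A : Type u} {m k : ℕ} (x : Fin k → A) (v : Fin m → A) (i : Fin m) :
    prepend k x v (oldVar k i) = v i := by
  simp [prepend, oldVar]

/-- The matrix of variables with the positions `f`, enumerated row by row. -/
def MatrixTerm.vars {n m : ℕ} (f : Fin (n * n) → Fin m) : MatrixTerm n m :=
  fun i j => .var (f (finProdFinEquiv (i, j)))

/-- The matrix with the entries `x`, enumerated row by row. -/
def toMatrix {A : Type u} {n : ℕ} (x : Fin (n * n) → A) : CStarMatrix (Fin n) (Fin n) A :=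
  CStarMatrix.ofMatrix fun i j => x (finProdFinEquiv (i, j))

/-- The entries of a matrix, enumerated row by row. -/
def ofEntries {A : Type u} {n : ℕ} (x : CStarMatrix (Fin n) (Fin n) A) : Fin (n * n) → A :=
  fun p => x (finProdFinEquiv.symm p).1 (finProdFinEquiv.symm p).2

theorem toMatrix_ofEntries {A : Type u} {n : ℕ} (x : CStarMatrix (Fin n) (Fin n) A) :
    toMatrix (ofEntries x) = x := by
  ext i j
  change x (finProdFinEquiv.symm (finProdFinEquiv (i, j))).1
    (finProdFinEquiv.symm (finProdFinEquiv (i, j))).2 = x i j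
  rw [Equiv.symm_apply_apply]

namespace Formula

/-- The formula in the variable `e` which measures how far `e` is from being a unit. -/
def unitDefect : Formula 1 :=
  .sup (.max (.norm (.sub (.mul (.var 1) (.var 0)) (.var 0)))
    (.norm (.sub (.mul (.var 0) (.var 1)) (.var 0))))

/-- The formula in the `n × n` matrices of variables `w`, `u` and the variable `e` which, when `e`
is the unit, says that `u` is close to `w ^ (k + 1)` if `u` is close to an isometry, that `w` is
close to `1`, and that `w` is unitary: it is at most `0` if and only if
`‖u - w ^ (k + 1)‖ ≤ c * ‖star u * u - 1‖`, `‖w - 1‖ ≤ 1` and `w` is unitary, with the sums of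
the norms of the entries in place of the norms. -/
def rootDefect (n k : ℕ) (c : ℝ) : Formula (1 + n * n + n * n) :=
  let w : MatrixTerm n (1 + n * n + n * n) := .vars (newVar (n * n))
  let u : MatrixTerm n (1 + n * n + n * n) := .vars fun p => oldVar (n * n) (newVar (n * n) p)
  let e : MatrixTerm n (1 + n * n + n * n) :=
    .scalar n (.var (oldVar (n * n) (oldVar (n * n) 0)))
  .max
    (.max (.subMul (u.sub (w.powSucc k)).entrySum c ((u.star.mul u).sub e).entrySum)
      (.subMul (w.sub e).entrySum 1 (.const 1)))
    (.max ((w.star.mul w).sub e).entrySum ((w.mul w.star).sub e).entrySum)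

/-- The sentence which says that there is a unit, and that every `n × n` matrix `u` with entries in
the unit ball is close, up to a multiple of its distance from an isometry, to the `k + 1`-st power
of a unitary at distance at most `1` from `1`. -/
def rootSentence (n k : ℕ) (c : ℝ) : Sentence :=
  .max (.const 0)
    (.inf (n := 0) (.max unitDefect (.sups (n * n) (.infs (n * n) (rootDefect n k c)))))

theorem eval_unitDefect_le {A : Type u} [NonUnitalCStarAlgebra A] {e : A} {c : ℝ}
    (h : ∀ y : A, ‖y‖ ≤ 1 → ‖e * y - y‖ ≤ c ∧ ‖y * e - y‖ ≤ c) (v : Fin 0 → A) :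
    unitDefect.eval A (Fin.cons e v) ≤ c := by
  refine eval_sup_le fun y hy => ?_
  rw [eval_max, eval_norm, eval_norm, Term.eval_sub, Term.eval_sub]
  exact max_le (h y hy).1 (h y hy).2

theorem le_of_eval_unitDefect_le {A : Type u} [NonUnitalCStarAlgebra A] {e : A} (he : ‖e‖ ≤ 1)
    {c : ℝ} {v : Fin 0 → A} (h : unitDefect.eval A (Fin.cons e v) ≤ c) {y : A} (hy : ‖y‖ ≤ 1) :
    ‖e * y - y‖ ≤ c ∧ ‖y * e - y‖ ≤ c := by
  have h' := (le_eval_sup _ (norm_cons_le he fun i => i.elim0) hy).trans h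
  rw [eval_max, eval_norm, eval_norm, Term.eval_sub, Term.eval_sub] at h'
  exact max_le_iff.1 h'

theorem eval_rootDefect_le_iff {A : Type u} [CStarAlgebra A] {n k : ℕ} {c δ : ℝ}
    {w u : Fin (n * n) → A} {v : Fin 1 → A} :
    (rootDefect n k c).eval A (prepend (n * n) w (prepend (n * n) u v)) ≤ δ ↔
      let e := CStarMatrix.ofMatrix (Matrix.diagonal fun _ : Fin n => v 0)
      (((toMatrix u - toMatrix w ^ (k + 1)).entrySum -
            c * (star (toMatrix u) * toMatrix u - e).entrySum ≤ δ) ∧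
          (toMatrix w - e).entrySum - 1 * 1 ≤ δ) ∧
        (star (toMatrix w) * toMatrix w - e).entrySum ≤ δ ∧
          (toMatrix w * star (toMatrix w) - e).entrySum ≤ δ := by
  have hw : (MatrixTerm.vars (newVar (n * n))).eval A
      (prepend (n * n) w (prepend (n * n) u v)) = toMatrix w := by
    ext i j
    exact prepend_newVar _ _ _
  have hu : (MatrixTerm.vars fun p => oldVar (n * n) (newVar (n * n) p)).eval A
      (prepend (n * n) w (prepend (n * n) u v)) = toMatrix u := by
    ext i j
    exact (prepend_oldVar _ _ _).trans (prepend_newVar _ _ _)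
  have he : (Term.var (oldVar (n * n) (oldVar (n * n) 0))).eval A
      (prepend (n * n) w (prepend (n * n) u v)) = v 0 :=
    (prepend_oldVar _ _ _).trans (prepend_oldVar _ _ _)
  simp only [rootDefect, eval_max, eval_subMul, eval_const, MatrixTerm.eval_entrySum,
    MatrixTerm.eval_sub, MatrixTerm.eval_mul, MatrixTerm.eval_star, MatrixTerm.eval_powSucc,
    MatrixTerm.eval_scalar, hw, hu, he, max_le_iff]
  rfl

end Formula

end CStarLogic

/-! ### Finite-dimensional and pseudocompact C⋆-algebras -/

namespace CStarLogic

open Formula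

/-- For a suitable exponent and constant, the sentence on roots holds in every finite-dimensional
C⋆-algebra. -/
theorem value_rootSentence_of_finiteDimensional (n : ℕ) (F : Type u)
    [inst₀ : NonUnitalCStarAlgebra F] [FiniteDimensional ℂ F] :
    (rootSentence n (4 * n * n) (2 * n * n)).value F = 0 := by
  obtain ⟨e, he, he'⟩ := NonUnitalCStarAlgebra.exists_unit_of_finiteDimensional F
  obtain ⟨inst, rfl⟩ := NonUnitalCStarAlgebra.exists_cstarAlgebra e he he'
  let := CStarAlgebra.spectralOrder F
  have := CStarAlgebra.spectralOrderedRing F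
  refine max_eq_left ((eval_inf_le _ (fun i => i.elim0) (CStarAlgebra.norm_one_le F)).trans ?_)
  refine max_le (eval_unitDefect_le (by simp [eval_const]) _) (eval_sups_le fun u hu => ?_)
  have h1 : ∀ i, ‖(Fin.cons 1 Fin.elim0 : Fin 1 → F) i‖ ≤ 1 :=
    norm_cons_le (CStarAlgebra.norm_one_le F) fun i => i.elim0
  suffices ∃ w : CStarMatrix (Fin n) (Fin n) F, w ∈ unitary _ ∧
      (toMatrix u - w ^ (4 * n * n + 1)).entrySum ≤
        2 * n * n * (star (toMatrix u) * toMatrix u - 1).entrySum ∧ (w - 1).entrySum ≤ 1 by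
    obtain ⟨w, hw, h, h'⟩ := this
    have hwn : ‖w‖ ≤ 1 := by
      rw [← mul_one w, CStarRing.norm_mem_unitary_mul _ hw]
      exact CStarAlgebra.norm_one_le _
    refine (eval_infs_le _ (norm_prepend_le hu h1)
      fun p => CStarMatrix.norm_entry_le_norm.trans hwn).trans
      (eval_rootDefect_le_iff.2 ?_ : (rootDefect n _ _).eval F (prepend _ (ofEntries w) _) ≤ 0)
    simp only [toMatrix_ofEntries, Fin.cons_zero, CStarMatrix.ofMatrix_diagonal_one,
      Unitary.star_mul_self_of_mem hw, Unitary.mul_star_self_of_mem hw, sub_self,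
      CStarMatrix.entrySum_zero, le_refl, and_true]
    exact ⟨by linarith, by linarith⟩
  have hn : (0 : ℝ) ≤ n * n := by positivity
  rcases lt_or_ge (star (toMatrix u) * toMatrix u - 1).entrySum 1 with h | h
  · obtain ⟨w, hw, h₁, h₂⟩ := CStarAlgebra.exists_unitary_norm_sub_pow_le
      ((CStarMatrix.norm_le_entrySum _).trans_lt h) (4 * n * n)
    refine ⟨w, hw, ?_, ?_⟩
    · have h₃ := CStarMatrix.norm_le_entrySum (star (toMatrix u) * toMatrix u - 1)
      have h₄ := CStarMatrix.entrySum_nonneg (star (toMatrix u) * toMatrix u - 1)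
      refine (CStarMatrix.entrySum_le _).trans ?_
      have := mul_le_mul_of_nonneg_left (h₁.trans h₃) hn
      nlinarith
    · refine (CStarMatrix.entrySum_le _).trans
        ((mul_le_mul_of_nonneg_left h₂ hn).trans ?_)
      rw [← mul_div_assoc, div_le_one (by positivity)]
      push_cast
      nlinarith [Real.pi_le_four]
  -- Far from the isometries the bound is weak enough to be satisfied by `w = 1`.
  · refine ⟨1, one_mem _, ?_, by simp [CStarMatrix.entrySum_zero]⟩
    rw [one_pow]
    have h₁ : (toMatrix u - 1).entrySum ≤ n * n * 2 := by
      refine CStarMatrix.entrySum_le_of_forall_le fun i j => (norm_sub_le _ _).trans ?_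
      have h₂ : ‖(1 : CStarMatrix (Fin n) (Fin n) F) i j‖ ≤ 1 :=
        CStarMatrix.norm_entry_le_norm.trans (CStarAlgebra.norm_one_le _)
      have h₃ : ‖toMatrix u i j‖ ≤ 1 := hu _
      linarith
    nlinarith

end CStarLogic

namespace IsPseudocompact

open CStarLogic Formula

/-- A pseudocompact C⋆-algebra satisfies the sentence on roots up to an arbitrarily small error,
since the infima in it need not be attained. -/
theorem exists_eval_rootDefect_le {A : Type u} [NonUnitalCStarAlgebra A] (hA : IsPseudocompact A)
    (n : ℕ) {δ : ℝ} (hδ : 0 < δ) :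
    ∃ e : A, ‖e‖ ≤ 1 ∧ (∀ y : A, ‖y‖ ≤ 1 → ‖e * y - y‖ ≤ δ ∧ ‖y * e - y‖ ≤ δ) ∧
      ∀ u : Fin (n * n) → A, (∀ p, ‖u p‖ ≤ 1) → ∃ w : Fin (n * n) → A,
        (rootDefect n (4 * n * n) (2 * n * n)).eval A
          (prepend (n * n) w (prepend (n * n) u (Fin.cons e Fin.elim0 : Fin 1 → A))) ≤ δ := by
  have h := hA _ fun F _ _ => value_rootSentence_of_finiteDimensional n F
  obtain ⟨e, he, h'⟩ := exists_of_eval_inf_lt ((max_eq_left_iff.1 h).trans_lt hδ)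
  obtain ⟨h₁, h₂⟩ := max_le_iff.1 h'.le
  refine ⟨e, he, fun y => le_of_eval_unitDefect_le he h₁, fun u hu => ?_⟩
  have h₃ := max_lt_iff.1 h'
  obtain ⟨w, -, hw⟩ := exists_of_eval_infs_lt
    ((le_eval_sups _ (norm_cons_le he fun i => i.elim0) hu).trans_lt h₃.2)
  exact ⟨w, hw.le⟩

theorem exists_unit {A : Type u} [NonUnitalCStarAlgebra A] (hA : IsPseudocompact A) :
    ∃ e : A, (∀ y, e * y = y) ∧ ∀ y, y * e = y :=
  NonUnitalCStarAlgebra.exists_unit_of_forall_exists_norm_sub_le fun _ hε =>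
    let ⟨e, he, he', _⟩ := hA.exists_eval_rootDefect_le 0 hε
    ⟨e, he, he'⟩

variable {A : Type u} [CStarAlgebra A]

theorem joined_one_cstarMatrix [PartialOrder A] [StarOrderedRing A] (hA : IsPseudocompact A)
    (n : ℕ) (u : unitary (CStarMatrix (Fin n) (Fin n) A)) : Joined 1 u := by
  set k := 4 * n * n + 1 with hk
  -- If the values of the formulas are at most `δ`, then replacing `e` by `1` leaves errors of at
  -- most `d * δ`, where the largest contribution is that of `star u * u - e`.
  set d : ℝ := 2 * n * n * (n * n * n) + n + 1 with hd
  have hd₁ : 1 ≤ d := by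
    have : (0 : ℝ) ≤ 2 * n * n * (n * n * n) + n := by positivity
    linarith
  have hnd : (n : ℝ) + 1 ≤ d := by
    have : (0 : ℝ) ≤ 2 * n * n * (n * n * n) := by positivity
    linarith
  set η : ℝ := 1 / (4 * 2 ^ k) with hη
  have hη₀ : 0 < η := by positivity
  have hkη : 2 ^ k * η = 1 / 4 := by rw [hη]; field_simp
  have hη₁ : η ≤ 1 / 4 := by
    have := one_le_pow₀ (one_le_two : (1 : ℝ) ≤ 2) (n := k)
    nlinarith
  obtain ⟨e, he, he', h⟩ := hA.exists_eval_rootDefect_le n (δ := η / d) (by positivity)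
  set δ := η / d with hδ
  have hδ₀ : 0 < δ := by positivity
  have hdδ : d * δ = η := by rw [hδ]; field_simp
  have hnδ : n * δ + δ ≤ η := by nlinarith
  have hun : ‖(u : CStarMatrix (Fin n) (Fin n) A)‖ ≤ 1 := by
    rw [← mul_one (u : CStarMatrix (Fin n) (Fin n) A), CStarRing.norm_coe_unitary_mul]
    exact CStarAlgebra.norm_one_le _
  obtain ⟨w, hw⟩ := h (ofEntries (u : CStarMatrix (Fin n) (Fin n) A)) fun p =>
    (CStarMatrix.norm_entry_le_norm (M := (u : CStarMatrix (Fin n) (Fin n) A))).trans hun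
  obtain ⟨⟨h₁, h₂⟩, h₃, h₄⟩ := eval_rootDefect_le_iff.1 hw
  rw [toMatrix_ofEntries, Unitary.coe_star_mul_self] at h₁
  rw [Fin.cons_zero] at h₁ h₂ h₃ h₄
  set E := CStarMatrix.ofMatrix (Matrix.diagonal fun _ : Fin n => e) with hE
  have hE₁ : ‖E - 1‖ ≤ n * δ := by
    refine (CStarMatrix.norm_ofMatrix_diagonal_sub_one_le e).trans ?_
    have := (he' 1 (CStarAlgebra.norm_one_le A)).1
    rw [mul_one] at this
    gcongr
  have key : ∀ {x : CStarMatrix (Fin n) (Fin n) A} {r : ℝ}, (x - E).entrySum ≤ r →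
      ‖x - 1‖ ≤ r + n * δ := fun {x r} hx => by
    rw [← sub_add_sub_cancel x E 1]
    exact (norm_add_le _ _).trans
      (add_le_add ((CStarMatrix.norm_le_entrySum _).trans hx) hE₁)
  have h₅ : (1 - E).entrySum ≤ n * n * (n * δ) := by
    refine (CStarMatrix.entrySum_le _).trans ?_
    rw [norm_sub_rev]
    gcongr
  have h₆ : 2 * n * n * (1 - E).entrySum ≤ 2 * n * n * (n * n * n) * δ := by
    refine (mul_le_mul_of_nonneg_left h₅ (by positivity)).trans_eq ?_
    ring
  have h₇ : d * δ = 2 * n * n * (n * n * n) * δ + n * δ + δ := by rw [hd]; ring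
  have hnδ₀ : 0 ≤ n * δ := by positivity
  refine CStarAlgebra.joined_one_of_norm_sub_pow_le (w := toMatrix w) (k := k) hη₁
    (by linarith) ?_ ?_ ?_ ?_
  · linarith [key (x := toMatrix w) (r := 1 + δ) (by linarith)]
  · linarith [key h₃]
  · linarith [key h₄]
  · refine (CStarMatrix.norm_le_entrySum _).trans ?_
    linarith

theorem joined_one_matrix (hA : IsPseudocompact A) (n : ℕ) (u : KOne.U A n) : Joined 1 u := by
  let := CStarAlgebra.spectralOrder A
  have := CStarAlgebra.spectralOrderedRing A
  let f : unitary (CStarMatrix (Fin n) (Fin n) A) → KOne.U A n :=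
    fun x => ⟨CStarMatrix.ofMatrix.symm x, x.2⟩
  have hf : Continuous f :=
    (CStarMatrix.ofMatrixL (A := A).symm.continuous.comp continuous_subtype_val).subtype_mk _
  exact (hA.joined_one_cstarMatrix n ⟨CStarMatrix.ofMatrix u, u.2⟩).map hf

theorem joined_one (hA : IsPseudocompact A) (u : unitary A) : Joined 1 u := by
  have h := hA.joined_one_matrix 1 ⟨Matrix.diagonal fun _ => u, by
    rw [Unitary.mem_iff]
    simp [Matrix.star_eq_conjTranspose, Matrix.diagonal_conjTranspose]⟩
  let f : KOne.U A 1 → unitary A := fun x => ⟨x.1 0 0, by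
    have h₁ := congrFun (congrFun (Unitary.mem_iff.1 x.2).1 0) 0
    have h₂ := congrFun (congrFun (Unitary.mem_iff.1 x.2).2 0) 0
    rw [Matrix.mul_apply, Fin.sum_univ_one] at h₁ h₂
    exact Unitary.mem_iff.2 ⟨h₁, h₂⟩⟩
  have hf : Continuous f := (continuous_subtype_val.matrix_elem 0 0).subtype_mk _
  exact h.map hf

theorem subsingleton_kOne (hA : IsPseudocompact A) : Subsingleton (KOne A) := by
  refine subsingleton_of_forall_eq 1 fun x => ?_
  induction x using DirectLimit.induction with
  | ih n x =>
    induction x using QuotientGroup.induction_on with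
    | H u =>
      rw [(QuotientGroup.eq_one_iff u).2 (hA.joined_one_matrix n u)]
      exact (DirectLimit.one_def n).symm

end IsPseudocompact

theorem proposition5p1 {A : Type u} [inst₀ : NonUnitalCStarAlgebra A] (hA : IsPseudocompact A) :
    ∃ inst : CStarAlgebra A, inst.toNonUnitalCStarAlgebra = inst₀ ∧
      (∀ v : unitary A, Joined (1 : unitary A) v) ∧
      ConnectedSpace (unitary A) ∧
      Subsingleton (KOne A) := by
  obtain ⟨e, he, he'⟩ := hA.exists_unit
  obtain ⟨inst, rfl⟩ := NonUnitalCStarAlgebra.exists_cstarAlgebra e he he'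
  have : PathConnectedSpace (unitary A) :=
    ⟨⟨1⟩, fun u v => (hA.joined_one u).symm.trans (hA.joined_one v)⟩
  exact ⟨inst, rfl, hA.joined_one, inferInstance, hA.subsingleton_kOne⟩
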